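/- Let $M=(M,HM,J)$ be a (connected) real-analytic CR-manifold: a real-analytic manifold $M$ with a real-analytic subbundle $HM\subset TM$ and a real-analytic bundle endomorphism $J$ of $HM$ with $J^2=-\mathrm{id}$, which can be realized as a real-analytic (embedded) submanifold of some complex manifold $Z$ in such a way that $H_aM=T_aM\cap iT_aM$ and $J\xi=i\xi$ for all $a\in M$, $\xi\in H_aM$. For open $W\subset M$ let $\mathfrak{hol}(W)$ be the space of all real-analytic vector fields on $W$ whose local flows consist of CR-transformations. Assume that $M$ is holomorphically nondegenerate, that is, for every $a\in M$ and every open neighbourhood $W$ of $a$, every $\xi\in\mathfrak{hol}(W)$ that is a section of $HM$ with $J\xi\in\mathfrak{hol}(W)$ vanishes in a neighbourhood of $a$. Let $V$ be a real vector space of finite dimension, $E:=V\oplus iV$ its complexification, $1\le k\le\infty$, let $F\subset V$ be an embedded submanifold of class $C^k$, and let $N$ be an open subset of the tube $V+iF\subset E$, with holomorphic tangent spaces $H_zN=T_zN\cap iT_zN$. Let $\varphi:N\to M$ be a $C^k$ CR-diffeomorphism, that is, a bijection such that $\varphi$ and $\varphi^{-1}$ are of class $C^k$ and their differentials map the holomorphic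 tangent spaces of $N$ and $M$ complex linearly into each other. Suppose that for every $v\in V$ the push-forward under $\varphi$ of the constant vector field $v\,\partial/\partial z$ on $N$ belongs to $\mathfrak{hol}(M)$. Then $N$ is a locally closed real-analytic submanifold of $E$, and $\varphi$ is a bianalytic CR-diffeomorphism, that is, both $\varphi:N\to M$ and $\varphi^{-1}:M\to N$ are real-analytic CR-maps. -/

import Mathlib

open Set Topology
open scoped Manifold ContDiff

/-! ## Embedded submanifolds of a finite-dimensional real vector space -/

/-- `S` is an embedded (hence locally closed) submanifold of class `C^k` of the normed space `X`,
described by slice charts; `k = ω` means real-analytic. -/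
def IsEmbeddedSubmanifold {X : Type*} [NormedAddCommGroup X] [NormedSpace ℝ X]
    (k : ℕ∞ω) (S : Set X) : Prop :=
  ∃ d : ℕ, ∀ a ∈ S, ∃ (L : Submodule ℝ X) (e : OpenPartialHomeomorph X X),
    Module.finrank ℝ L = d ∧ a ∈ e.source ∧
    ContDiffOn ℝ k e e.source ∧ ContDiffOn ℝ k e.symm e.target ∧
    ∀ x ∈ e.source, x ∈ S ↔ e x ∈ L

/-! ## Tubes -/

section Tube

variable {E : Type*} [NormedAddCommGroup E] [NormedSpace ℂ E]

/-- The complex vector space `E` is the complexification `V ⊕ iV` of its real subspace `V`. -/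
def IsComplexificationOf (V : Submodule ℝ E) : Prop :=
  IsCompl V (V.map (Complex.I • (LinearMap.id : E →ₗ[ℝ] E)))

/-- The tube `V + iF` over the base `F ⊆ V`. -/
def tube (V : Submodule ℝ E) (F : Set V) : Set E :=
  {z | ∃ x : V, ∃ y ∈ F, z = (x : E) + Complex.I • (y : E)}

/-- The holomorphic tangent space `T_z N ∩ i T_z N` at `z` of a submanifold `N` of `E`
(as `-T_z N = T_z N`, one has `v ∈ i T_z N` exactly if `i v ∈ T_z N`).
For a `C^1`-submanifold the tangent cone is the tangent space `T_z N ⊆ E`. -/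
def holTangent (N : Set E) (z : E) : Set E :=
  {v | v ∈ tangentConeAt ℝ N z ∧ Complex.I • v ∈ tangentConeAt ℝ N z}

end Tube

/-! ## Real-analytic CR-manifolds -/

section CR

variable {EM : Type*} [NormedAddCommGroup EM] [NormedSpace ℝ EM]
  {M : Type*} [TopologicalSpace M] [ChartedSpace EM M] [IsManifold 𝓘(ℝ, EM) ω M]

/-- The vector field `ξ` is real-analytic on `W`. -/
def IsAnalyticField (ξ : ∀ x : M, TangentSpace 𝓘(ℝ, EM) x) (W : Set M) : Prop :=
  ContMDiffOn 𝓘(ℝ, EM) (𝓘(ℝ, EM).tangent) ω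
    (fun x => (⟨x, ξ x⟩ : TangentBundle 𝓘(ℝ, EM) M)) W

/-- The differential at `x` of a map `f : M → Z` into a complex manifold `Z` modelled on `E`, with
values in `E`: the tangent space of `Z` at `f x` is the complex vector space `E` (by means of the
preferred holomorphic chart at `f x`), and multiplication by `i` on it is that of `E`. -/
noncomputable def diffC {E : Type*} [NormedAddCommGroup E] [NormedSpace ℂ E]
    {Z : Type*} [TopologicalSpace Z] [ChartedSpace E Z] (f : M → Z) (x : M) :
    TangentSpace 𝓘(ℝ, EM) x →L[ℝ] E :=
  mfderiv 𝓘(ℝ, EM) 𝓘(ℝ, E) f x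

/-- `Φ` is a local flow of the vector field `ξ` inside the open set `W`, defined for initial points
in `U` and times in `(-ε, ε)`. -/
structure IsLocalFlow (ξ : ∀ x : M, TangentSpace 𝓘(ℝ, EM) x) (W U : Set M) (ε : ℝ)
    (Φ : ℝ → M → M) : Prop where
  isOpen : IsOpen U
  subset : U ⊆ W
  pos : 0 < ε
  zero : ∀ x ∈ U, Φ 0 x = x
  mem : ∀ x ∈ U, ∀ t ∈ Ioo (-ε) ε, Φ t x ∈ W
  isMIntegralCurveOn : ∀ x ∈ U, IsMIntegralCurveOn (fun t => Φ t x) ξ (Ioo (-ε) ε)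

variable (EM M) in
/-- A CR-structure `(HM, J)` on the real-analytic manifold `M`: a real-analytic subbundle `HM` of
the tangent bundle with a real-analytic bundle endomorphism `J` of `HM` satisfying `J² = -id`. -/
structure CRStructure where
  /-- the holomorphic tangent spaces -/
  H : ∀ x : M, Submodule ℝ (TangentSpace 𝓘(ℝ, EM) x)
  /-- the complex structures of the holomorphic tangent spaces -/
  J : ∀ x : M, H x →ₗ[ℝ] H x
  J_sq : ∀ (x : M) (v : H x), J x (J x v) = -v
  /-- near every point there is a real-analytic frame `X` of `HM`, with `J X` real-analytic too -/
  exists_frame : ∀ a : M, ∃ U ∈ 𝓝 a, ∃ (r : ℕ) (X Y : Fin r → ∀ x : M, TangentSpace 𝓘(ℝ, EM) x),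
    (∀ i, IsAnalyticField (X i) U ∧ IsAnalyticField (Y i) U) ∧
    ∀ x ∈ U, LinearIndependent ℝ (fun i => X i x) ∧
      Submodule.span ℝ (range fun i => X i x) = H x ∧
      ∀ i, ∃ h : X i x ∈ H x, (J x ⟨X i x, h⟩ : TangentSpace 𝓘(ℝ, EM) x) = Y i x

namespace CRStructure

variable (S : CRStructure EM M)

/-- `ι : M → Z` realizes the CR-manifold `M` as a real-analytic submanifold of the complex manifold
`Z`: it is a real-analytic embedding, `HM = TM ∩ iTM` and `J` is the multiplication by `i`
(the tangent spaces of `Z` are copies of the complex vector space `EZ`). -/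
structure IsRealizedBy {EZ : Type*} [NormedAddCommGroup EZ] [NormedSpace ℂ EZ]
    {Z : Type*} [TopologicalSpace Z] [ChartedSpace EZ Z] (ι : M → Z) : Prop where
  contMDiff : ContMDiff 𝓘(ℝ, EM) 𝓘(ℝ, EZ) ω ι
  isEmbedding : IsEmbedding ι
  injective_diff : ∀ x, Function.Injective (diffC (EM := EM) (E := EZ) ι x)
  mem_H_iff : ∀ (x : M) (v : TangentSpace 𝓘(ℝ, EM) x), v ∈ S.H x ↔
    ∃ w : TangentSpace 𝓘(ℝ, EM) x, diffC (E := EZ) ι x w = Complex.I • diffC (E := EZ) ι x v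
  map_J : ∀ (x : M) (v : S.H x),
    diffC (E := EZ) ι x (S.J x v : TangentSpace 𝓘(ℝ, EM) x) =
      Complex.I • diffC (E := EZ) ι x (v : TangentSpace 𝓘(ℝ, EM) x)

/-- `f` is a real-analytic CR-map from the open set `U ⊆ M` to `M`. -/
def IsCRMapOn (f : M → M) (U : Set M) : Prop :=
  ContMDiffOn 𝓘(ℝ, EM) 𝓘(ℝ, EM) ω f U ∧
  ∀ x ∈ U, ∀ v : S.H x,
    ∃ h : mfderiv 𝓘(ℝ, EM) 𝓘(ℝ, EM) f x (v : TangentSpace 𝓘(ℝ, EM) x) ∈ S.H (f x),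
      (S.J (f x) ⟨_, h⟩ : TangentSpace 𝓘(ℝ, EM) (f x)) =
        mfderiv 𝓘(ℝ, EM) 𝓘(ℝ, EM) f x (S.J x v : TangentSpace 𝓘(ℝ, EM) x)

/-- `ξ ∈ hol(W)` for the open subset `W` of the CR-manifold `M`: `ξ` is a real-analytic vector field
on `W` whose local flow consists of CR-transformations. -/
def IsHol (W : Set M) (ξ : ∀ x : M, TangentSpace 𝓘(ℝ, EM) x) : Prop :=
  IsAnalyticField ξ W ∧
  ∀ (U : Set M) (ε : ℝ) (Φ : ℝ → M → M), IsLocalFlow ξ W U ε Φ →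
    ∀ t ∈ Ioo (-ε) ε, S.IsCRMapOn (Φ t) U

/-- `M` is holomorphically nondegenerate: at every point `a`, one has `𝔤 ∩ i𝔤 = 0` for the space
`𝔤 = hol(M, a)` of germs at `a`. An element of `𝔤 ∩ i𝔤` is given by some `ξ ∈ 𝔤` such that `iξ` is
tangent to `M`, that is, `ξ` is a section of `HM`, and `Jξ ∈ 𝔤`. -/
def IsHolNondegenerate : Prop :=
  ∀ (a : M) (W : Set M), IsOpen W → a ∈ W →
    ∀ ξ η : ∀ x : M, TangentSpace 𝓘(ℝ, EM) x, S.IsHol W ξ → S.IsHol W η →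
      (∀ x ∈ W, ∃ h : ξ x ∈ S.H x, (S.J x ⟨ξ x, h⟩ : TangentSpace 𝓘(ℝ, EM) x) = η x) →
      ∀ᶠ x in 𝓝 a, ξ x = 0

/-- `φ` restricts to a CR-diffeomorphism of class `C^k` from the submanifold `N` of the complex
vector space `E` onto the CR-manifold `M`: `φ` and its inverse `ψ : M → N`
are of class `C^k` and map the holomorphic tangent spaces complex linearly to each other. Values of
`φ` off `N` are irrelevant. The derivative `mfderivWithin … φ N z` is only applied to tangent vectors
of `N`, where it is uniquely determined. -/
def IsCRDiffeo {E : Type*} [NormedAddCommGroup E] [NormedSpace ℂ E]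
    (k : ℕ∞ω) (N : Set E) (φ : E → M) : Prop :=
  ContMDiffOn 𝓘(ℝ, E) 𝓘(ℝ, EM) k φ N ∧
  (∀ z ∈ N, ∀ v ∈ holTangent N z,
    ∃ h : mfderivWithin 𝓘(ℝ, E) 𝓘(ℝ, EM) φ N z v ∈ S.H (φ z),
      (S.J (φ z) ⟨_, h⟩ : TangentSpace 𝓘(ℝ, EM) (φ z)) =
        mfderivWithin 𝓘(ℝ, E) 𝓘(ℝ, EM) φ N z (Complex.I • v : E)) ∧
  ∃ ψ : M → E,
    (∀ z ∈ N, ψ (φ z) = z) ∧ (∀ x, ψ x ∈ N ∧ φ (ψ x) = x) ∧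
    ContMDiff 𝓘(ℝ, EM) 𝓘(ℝ, E) k ψ ∧
    ∀ (x : M) (v : S.H x),
      diffC (E := E) ψ x (v : TangentSpace 𝓘(ℝ, EM) x) ∈ holTangent N (ψ x) ∧
      diffC (E := E) ψ x (S.J x v : TangentSpace 𝓘(ℝ, EM) x) =
        Complex.I • diffC (E := E) ψ x (v : TangentSpace 𝓘(ℝ, EM) x)

end CRStructure

end CR

/-! Let `ψ : M → N` be the inverse of `φ` and `ξ v` the push-forward of the constant field `v ∈ V`.
Then `dψ` solves a linear system with real-analytic coefficients: `dψ (ξ v) = v` for `v` in a basis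
of `V`, and `dψ (J X) = i dψ X` for `X` in a real-analytic frame of `HM`.

The system has only one solution because `N` is open in a tube. A tangent vector of `N` can be
written `v + iu` with `v, u ∈ V`. Translations along `V` make `v` and `u` tangent to `N`, hence `iu`
is tangent too, so `u` lies in the holomorphic tangent space and `dφ (iu) = J (dφ u)`. Thus every
tangent vector of `M` is `ξ v + J (ξ u)` at the given point, with `ξ u` in `HM` there, and the
equations fix the value of `dψ` on it.

Solving the system shows that `dψ` is real-analytic in charts (`contDiffAt_omega_of_linear_system`),
and integrating shows the same for `ψ` (`analyticAt_of_analyticAt_fderiv`). So `ψ` is a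
real-analytic injective immersion whose inverse on `N` is continuous, that is, an embedding;
`isEmbeddedSubmanifold_of_analytic_immersion` gives the submanifold structure of `N` and the
analyticity of `φ`. -/

/-! ### Analyticity from the differential -/

/-- A function whose derivative is real-analytic at a point is itself real-analytic there. -/
theorem analyticAt_of_analyticAt_fderiv {X Y : Type*} [NormedAddCommGroup X] [NormedSpace ℝ X]
    [NormedAddCommGroup Y] [NormedSpace ℝ Y] [CompleteSpace Y] {f : X → Y} {a : X}
    (hf : ∀ᶠ x in 𝓝 a, DifferentiableAt ℝ f x) (h : AnalyticAt ℝ (fderiv ℝ f) a) :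
    AnalyticAt ℝ f a := by
  obtain ⟨p, r, hp⟩ := h
  obtain ⟨ε, hε, hfε⟩ := Metric.eventually_nhds_iff_ball.1 hf
  obtain ⟨s, hs, hsp, hsε⟩ : ∃ s : ENNReal, 0 < s ∧ s ≤ r ∧ s ≤ ENNReal.ofReal ε :=
    ⟨min r (ENNReal.ofReal ε), lt_min hp.r_pos (ENNReal.ofReal_pos.2 hε), min_le_left _ _,
      min_le_right _ _⟩
  replace hp := hp.mono hs hsp
  have hd : ∀ x ∈ Metric.eball a s, DifferentiableAt ℝ f x := fun x hx =>
    hfε x (by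
      have := Metric.eball_subset_eball hsε hx
      rwa [Metric.eball_ofReal] at this)
  -- The termwise integral of `t ↦ p (t • y) y` over `[0, 1]`: degree `n` goes to degree `n + 1`
  -- with factor `1 / (n + 1)`. The convention `0⁻¹ = 0` makes the constant term vanish, so `q` is
  -- to represent `f - f a`.
  let q : FormalMultilinearSeries ℝ X Y := fun n => ((n : ℝ)⁻¹) • p.unshift 0 n
  have hq0 : ∀ v, q 0 v = 0 := fun v => by simp [q]
  have hqs : ∀ (n : ℕ) (y : X),
      q (n + 1) (fun _ => y) = ((n : ℝ) + 1)⁻¹ • p n (fun _ => y) y := by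
    intro n y
    simp [q, FormalMultilinearSeries.unshift, Fin.init_def]
  have hqn : ∀ n : ℕ, ‖q (n + 1)‖ ≤ ‖p n‖ := by
    intro n
    have h1 : ‖p.unshift (0 : Y) (n + 1)‖ = ‖p n‖ := ContinuousMultilinearMap.uncurryRight_norm _
    have h2 : ‖(((n + 1 : ℕ) : ℝ))⁻¹‖ ≤ 1 := by
      rw [norm_inv, Real.norm_natCast]
      exact inv_le_one_of_one_le₀ (by exact_mod_cast Nat.le_add_left 1 n)
    calc ‖q (n + 1)‖ = ‖(((n + 1 : ℕ) : ℝ))⁻¹‖ * ‖p n‖ := by rw [← h1]; exact norm_smul _ _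
      _ ≤ 1 * ‖p n‖ := by gcongr
      _ = ‖p n‖ := one_mul _
  have hqr : s ≤ q.radius := by
    refine ENNReal.le_of_forall_nnreal_lt fun t ht => ?_
    obtain ⟨C, -, hC⟩ := p.norm_mul_pow_le_of_lt_radius (ht.trans_le hp.r_le)
    refine q.le_radius_of_bound (max ‖q 0‖ (C * t)) fun n => ?_
    rcases n with _ | n
    · simp
    · refine le_max_of_le_right ?_
      calc ‖q (n + 1)‖ * (t : ℝ) ^ (n + 1) ≤ ‖p n‖ * (t : ℝ) ^ (n + 1) := by gcongr; exact hqn n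
        _ = ‖p n‖ * (t : ℝ) ^ n * t := by ring
        _ ≤ C * t := by gcongr; exact hC n
  have key : HasFPowerSeriesOnBall (fun x => f x - f a) q a s := by
    refine ⟨hqr, hs, fun {y} hy => ?_⟩
    have hmem : ∀ t ∈ Icc (0 : ℝ) 1, t • y ∈ Metric.eball (0 : X) s := by
      intro t ht
      have : ‖t • y‖ₑ ≤ ‖y‖ₑ := by
        rw [enorm_le_iff_norm_le, norm_smul, Real.norm_of_nonneg ht.1]
        exact mul_le_of_le_one_left (norm_nonneg _) ht.2
      rw [mem_eball_zero_iff] at hy ⊢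
      exact this.trans_lt hy
    have hmem' : ∀ t ∈ Icc (0 : ℝ) 1, a + t • y ∈ Metric.eball a s := by
      intro t ht
      have := hmem t ht
      rw [mem_eball_zero_iff] at this
      simpa [Metric.mem_eball, edist_eq_enorm_sub] using this
    have hu : uIcc (0 : ℝ) 1 = Icc 0 1 := uIcc_of_le zero_le_one
    have hcont : ContinuousOn (fun t : ℝ => fderiv ℝ f (a + t • y) y) (Icc 0 1) := by
      refine ContinuousOn.clm_apply ?_ continuousOn_const
      exact hp.continuousOn.comp (by fun_prop) hmem'
    have hint : ∫ t in (0 : ℝ)..1, fderiv ℝ f (a + t • y) y = f (a + y) - f a := by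
      have := intervalIntegral.integral_eq_sub_of_hasDerivAt (a := (0 : ℝ)) (b := 1)
        (f := fun t : ℝ => f (a + t • y)) (f' := fun t : ℝ => fderiv ℝ f (a + t • y) y) ?_ ?_
      · simpa using this
      · intro t ht
        rw [hu] at ht
        have h1 : HasDerivAt (fun t : ℝ => a + t • y) y t := by
          simpa using ((hasDerivAt_id t).smul_const y).const_add a
        exact (hd _ (hmem' t ht)).hasFDerivAt.comp_hasDerivAt t h1
      · exact ContinuousOn.intervalIntegrable (by rwa [hu])
    -- Sum and integral are exchanged; by the fundamental theorem of calculus along the segment from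
    -- `a` to `a + y`, the total is `f (a + y) - f a`.
    have hsum := intervalIntegral.hasSum_intervalIntegral_of_summable_norm (a := (0 : ℝ)) (b := 1)
      (f := fun n : ℕ => ⟨fun t : ℝ => t ^ n • (p n (fun _ => y) y), by fun_prop⟩) ?_
    · have e1 : (∫ t in (0 : ℝ)..1, ∑' n : ℕ, t ^ n • (p n (fun _ => y) y)) =
          ∫ t in (0 : ℝ)..1, fderiv ℝ f (a + t • y) y := by
        refine intervalIntegral.integral_congr fun t ht => ?_
        rw [hu] at ht
        have := ((ContinuousLinearMap.apply ℝ Y y).hasSum (hp.hasSum (hmem t ht))).tsum_eq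
        simp only [ContinuousLinearMap.apply_apply] at this
        simp only [← this]
        refine tsum_congr fun n => ?_
        rw [(p n).map_smul_univ (fun _ => t) (fun _ => y)]
        simp
      have e2 : ∀ n : ℕ, (∫ t in (0 : ℝ)..1, t ^ n • (p n (fun _ => y) y)) =
          q (n + 1) (fun _ => y) := by
        intro n
        rw [intervalIntegral.integral_smul_const, hqs, integral_pow]
        simp
      simp only [ContinuousMap.coe_mk, e1, e2, hint] at hsum
      rw [← hasSum_nat_add_iff' 1]
      simpa [hq0] using hsum
    · have hsm := (p.summable_norm_apply (x := y)
        (Metric.eball_subset_eball hp.r_le hy)).mul_right ‖y‖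
      refine Summable.of_nonneg_of_le (fun n => norm_nonneg _) (fun n => ?_) hsm
      rw [ContinuousMap.norm_le _ (by positivity)]
      rintro ⟨t, ht⟩
      have ht' : t ∈ Icc (0 : ℝ) 1 := by simpa [hu] using ht
      simp only [ContinuousMap.restrict_apply, ContinuousMap.coe_mk, norm_smul, norm_pow,
        Real.norm_of_nonneg ht'.1]
      calc t ^ n * ‖p n (fun _ => y) y‖ ≤ 1 * (‖p n (fun _ => y)‖ * ‖y‖) := by
            gcongr
            · exact pow_le_one₀ ht'.1 ht'.2
            · exact ContinuousLinearMap.le_opNorm _ _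
        _ = _ := one_mul _
  have := key.analyticAt.add (analyticAt_const (v := f a))
  refine this.congr (Filter.Eventually.of_forall fun x => ?_)
  simp

/-- A solution `P` of an overdetermined linear system with real-analytic coefficients is
real-analytic at every point where the system determines `P` uniquely. -/
theorem contDiffAt_omega_of_linear_system {X E κ : Type*} [NormedAddCommGroup X] [NormedSpace ℝ X]
    [FiniteDimensional ℝ X] [NormedAddCommGroup E] [NormedSpace ℝ E] [FiniteDimensional ℝ E]
    [Fintype κ] (T : E →L[ℝ] E) {P : X → X →L[ℝ] E} {Y Z : κ → X → X} {b : κ → E} {a : X}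
    (hY : ∀ i, ContDiffAt ℝ ω (Y i) a) (hZ : ∀ i, ContDiffAt ℝ ω (Z i) a)
    (hP : ∀ᶠ x in 𝓝 a, ∀ i, P x (Y i x) - T (P x (Z i x)) = b i)
    (huniq : ∀ Q : X →L[ℝ] E, (∀ i, Q (Y i a) - T (Q (Z i a)) = 0) → Q = 0) :
    ContDiffAt ℝ ω P a := by
  classical
  have : CompleteSpace (X →L[ℝ] E) := FiniteDimensional.complete ℝ _
  -- The system reads `A x (P x) = b`, with `A` real-analytic and `A a` injective.
  let A : X → (X →L[ℝ] E) →L[ℝ] (κ → E) := fun x =>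
    ∑ i, ContinuousLinearMap.single ℝ (fun _ : κ => E) i ∘L
      (ContinuousLinearMap.apply ℝ E (Y i x) - T ∘L ContinuousLinearMap.apply ℝ E (Z i x))
  have hAapp : ∀ x Q i, A x Q i = Q (Y i x) - T (Q (Z i x)) := by
    intro x Q i
    simp [A, sum_apply, Finset.sum_apply, Pi.single_apply]
  have hA : ContDiffAt ℝ ω A a := by
    refine ContDiffAt.sum fun i _ => contDiffAt_const.clm_comp ?_
    exact ((ContinuousLinearMap.apply ℝ E).contDiff.contDiffAt.comp a (hY i)).sub
      (contDiffAt_const.clm_comp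
        ((ContinuousLinearMap.apply ℝ E).contDiff.contDiffAt.comp a (hZ i)))
  have hker : LinearMap.ker (A a : (X →L[ℝ] E) →ₗ[ℝ] (κ → E)) = ⊥ := by
    rw [LinearMap.ker_eq_bot']
    intro Q hQ
    exact huniq Q fun i => (hAapp a Q i).symm.trans (congrFun hQ i)
  -- With a left inverse `B` of `A a`, the operator `B ∘ A x` is the identity at `x = a`, hence
  -- invertible nearby, and `P x = (B ∘ A x)⁻¹ (B b)`.
  obtain ⟨g, hg⟩ := LinearMap.exists_leftInverse_of_injective _ hker
  let B : (κ → E) →L[ℝ] (X →L[ℝ] E) := LinearMap.toContinuousLinearMap g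
  have hBA : B ∘L A a = (ContinuousLinearEquiv.refl ℝ (X →L[ℝ] E) : _ →L[ℝ] _) := by
    ext1 Q
    exact LinearMap.congr_fun hg Q
  have hC : ContDiffAt ℝ ω (fun x => B ∘L A x) a := contDiffAt_const.clm_comp hA
  have hunit : ∀ᶠ x in 𝓝 a, (B ∘L A x).IsInvertible := by
    have := ContinuousLinearEquiv.nhds (ContinuousLinearEquiv.refl ℝ (X →L[ℝ] E))
    rw [← hBA] at this
    exact hC.continuousAt.eventually_mem this
  have hinv : ContDiffAt ℝ ω (fun x => (B ∘L A x).inverse (B b)) a := by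
    refine ContDiffAt.clm_apply ?_ contDiffAt_const
    have : ContDiffAt ℝ ω ContinuousLinearMap.inverse (B ∘L A a) := by
      rw [hBA]
      exact contDiffAt_map_inverse _
    exact this.comp a hC
  refine hinv.congr_of_eventuallyEq ?_
  filter_upwards [hP, hunit] with x hx hux
  have h1 : A x (P x) = b := funext fun i => (hAapp x _ i).trans (hx i)
  obtain ⟨u, hu⟩ := hux
  have h2 : B (A x (P x)) = u (P x) := (DFunLike.congr_fun hu (P x)).symm
  rw [← h1, h2, ← hu, ContinuousLinearMap.inverse_equiv]
  exact (u.symm_apply_apply _).symm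

/-! ### Real-analytic immersions and slices -/

/-- The local form of a real-analytic immersion `f`: its image is locally a slice, and it has a
real-analytic local left inverse `g`. -/
theorem exists_slice_chart_of_injective_fderiv {X E : Type*} [NormedAddCommGroup X]
    [NormedSpace ℝ X] [FiniteDimensional ℝ X] [NormedAddCommGroup E] [NormedSpace ℝ E]
    [FiniteDimensional ℝ E] {f : X → E} {a : X} (hf : ContDiffAt ℝ ω f a)
    (hinj : Function.Injective (fderiv ℝ f a)) :
    ∃ (L : Submodule ℝ E) (e : OpenPartialHomeomorph E E) (g : E → X),
      Module.finrank ℝ L = Module.finrank ℝ X ∧ f a ∈ e.source ∧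
      ContDiffOn ℝ ω e e.source ∧ ContDiffOn ℝ ω e.symm e.target ∧
      ContDiffOn ℝ ω g e.source ∧ (∀ w ∈ e.source, e w ∈ L → f (g w) = w) ∧
      ∀ᶠ x in 𝓝 a, f x ∈ e.source → e (f x) ∈ L ∧ g (f x) = x := by
  have : CompleteSpace X := FiniteDimensional.complete ℝ X
  have : CompleteSpace E := FiniteDimensional.complete ℝ E
  set f' : X →ₗ[ℝ] E := (fderiv ℝ f a : X →ₗ[ℝ] E) with hf'
  obtain ⟨C, hC⟩ := (LinearMap.range f').exists_isCompl
  let Φ₀ : (X × C) ≃ₗ[ℝ] E :=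
    ((LinearEquiv.ofInjective f' hinj).prodCongr (LinearEquiv.refl ℝ C)).trans
      (Submodule.prodEquivOfIsCompl _ _ hC)
  let Φ : (X × C) ≃L[ℝ] E := Φ₀.toContinuousLinearEquiv
  have hΦ : ∀ p : X × C, Φ p = f' p.1 + p.2 := fun p => rfl
  -- Thickening `f` by a complement `C` of the range of its differential makes the differential
  -- invertible; the inverse function theorem then straightens the image of `f` to `C`-coordinate
  -- zero.
  let G : X × C → E := fun p => f p.1 + (p.2 : E)
  have hG : ContDiffAt ℝ ω G (a, 0) :=
    (ContDiffAt.comp (a, (0 : C)) hf contDiffAt_fst).add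
      (C.subtypeL.contDiff.contDiffAt.comp (a, (0 : C)) contDiffAt_snd)
  have hG' : HasFDerivAt G (Φ : X × C →L[ℝ] E) (a, 0) := by
    have h1 : HasFDerivAt (fun p : X × C => f p.1)
        (fderiv ℝ f a ∘L ContinuousLinearMap.fst ℝ X C) (a, 0) :=
      HasFDerivAt.comp (a, (0 : C)) (hf.differentiableAt (by simp)).hasFDerivAt hasFDerivAt_fst
    have h2 : HasFDerivAt (fun p : X × C => (p.2 : E))
        (C.subtypeL ∘L ContinuousLinearMap.snd ℝ X C) (a, 0) :=
      (C.subtypeL ∘L ContinuousLinearMap.snd ℝ X C).hasFDerivAt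
    refine (h1.add h2).congr_fderiv ?_
    ext p <;> simp [hΦ, hf']
  have hω : (ω : ℕ∞ω) ≠ 0 := by simp
  let eG := hG.toOpenPartialHomeomorph G hG' hω
  have hmem : ((a, 0) : X × C) ∈ eG.source := hG.mem_toOpenPartialHomeomorph_source hG' hω
  have heG : ∀ p, eG p = G p := fun p => rfl
  have hGa : G (a, 0) = f a := by simp [G]
  have hGat : f a ∈ eG.target := by
    rw [← hGa]
    exact eG.map_source hmem
  have hsymm_a : eG.symm (f a) = (a, 0) := by
    rw [← hGa]
    exact eG.left_inv hmem
  have hs : ContDiffAt ℝ ω eG.symm (f a) := by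
    refine eG.contDiffAt_symm (f₀' := Φ) hGat ?_ ?_ <;> rw [hsymm_a]
    · exact hG'
    · exact hG
  -- Analyticity of `G` at the preimages is needed as well, since `e.symm` is `G ∘ Φ.symm`.
  have ev : ∀ᶠ w in 𝓝 (f a), ContDiffAt ℝ ω eG.symm w ∧ ContDiffAt ℝ ω G (eG.symm w) := by
    refine (hs.eventually (by simp)).and (hs.continuousAt.eventually ?_)
    rw [hsymm_a]
    exact hG.eventually (by simp)
  obtain ⟨W, hW, hWo, haW⟩ := eventually_nhds_iff.1 ev
  let e : OpenPartialHomeomorph E E :=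
    (eG.symm.trans Φ.toHomeomorph.toOpenPartialHomeomorph).restrOpen W hWo
  have hes : e.source = eG.target ∩ W := by simp [e]
  have he : ∀ w, e w = Φ (eG.symm w) := fun w => rfl
  have hL : ∀ w, e w ∈ LinearMap.range f' ↔ (eG.symm w).2 = 0 := by
    intro w
    rw [he, hΦ, Submodule.add_mem_iff_right _ (LinearMap.mem_range_self f' _)]
    constructor
    · intro h
      have := hC.disjoint.le_bot ⟨h, (eG.symm w).2.2⟩
      exact Subtype.ext (by simpa using this)
    · intro h
      simp [h]
  refine ⟨LinearMap.range f', e, fun w => (eG.symm w).1, LinearMap.finrank_range_of_inj hinj,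
    hes ▸ ⟨hGat, haW⟩, ?_, ?_, ?_, ?_, ?_⟩
  · intro w hw
    rw [hes] at hw
    exact (Φ.contDiff.contDiffAt.comp w (hW w hw.2).1).contDiffWithinAt
  · intro u hu
    have h1 := e.map_target hu
    rw [hes] at h1
    have h2 : eG.symm (e.symm u) = Φ.symm u := by
      have := e.right_inv hu
      rw [he] at this
      rw [← this, Φ.symm_apply_apply, this]
    have h3 := (hW _ h1.2).2
    rw [h2] at h3
    exact (ContDiffAt.comp u h3 Φ.symm.contDiff.contDiffAt).contDiffWithinAt
  · intro w hw
    rw [hes] at hw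
    exact (contDiffAt_fst.comp w (hW w hw.2).1).contDiffWithinAt
  · intro w hw hwL
    rw [hL] at hwL
    rw [hes] at hw
    have : G (eG.symm w) = w := eG.right_inv hw.1
    simpa [G, hwL] using this
  · have hcont : ContinuousAt (fun x : X => (x, (0 : C))) a := by fun_prop
    filter_upwards [hcont.eventually_mem (eG.open_source.mem_nhds hmem)] with x hx _
    have : eG.symm (f x) = (x, 0) := by
      have := eG.left_inv hx
      rwa [heG, show G (x, 0) = f x by simp [G]] at this
    refine ⟨(hL _).2 ?_, ?_⟩ <;> simp [this]

/-- In a slice chart `S` is the preimage of a finite-dimensional, hence closed, subspace. -/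
theorem IsEmbeddedSubmanifold.isLocallyClosed {X : Type*} [NormedAddCommGroup X]
    [NormedSpace ℝ X] [FiniteDimensional ℝ X] {k : ℕ∞ω} {S : Set X}
    (h : IsEmbeddedSubmanifold k S) : IsLocallyClosed S := by
  obtain ⟨d, h⟩ := h
  refine ((isLocallyClosed_tfae S).out 0 3 :).2 fun a ha => ?_
  obtain ⟨L, e, -, hae, -, -, hS⟩ := h a ha
  refine ⟨e.source, hae, e.open_source, ?_⟩
  rintro x ⟨hx, hxS⟩
  rw [hS x hx, ← SetLike.mem_coe, ← L.closed_of_finiteDimensional.closure_eq]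
  have h1 : x ∈ closure (e.source ∩ S) := e.open_source.inter_closure ⟨hx, hxS⟩
  exact (e.continuousAt hx).continuousWithinAt.mem_closure h1 fun y hy => (hS y hy.1).1 hy.2

/-! ### Passing to charts of `M` -/

section Manifold

variable {EM : Type*} [NormedAddCommGroup EM] [NormedSpace ℝ EM]
  {M : Type*} [TopologicalSpace M] [ChartedSpace EM M] [IsManifold 𝓘(ℝ, EM) ω M]
  {E : Type*} [NormedAddCommGroup E] [NormedSpace ℝ E]

theorem mfderiv_comp_chartAt_symm {ψ : M → E} {a : M} {y : EM}
    (hy : y ∈ (chartAt EM a).target)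
    (hψ : MDifferentiableAt 𝓘(ℝ, EM) 𝓘(ℝ, E) ψ ((chartAt EM a).symm y)) :
    DifferentiableAt ℝ (ψ ∘ (chartAt EM a).symm) y ∧
      fderiv ℝ (ψ ∘ (chartAt EM a).symm) y =
        (mfderiv 𝓘(ℝ, EM) 𝓘(ℝ, E) ψ ((chartAt EM a).symm y)).comp
          (mfderiv 𝓘(ℝ, EM) 𝓘(ℝ, EM) (chartAt EM a).symm y) := by
  have : IsManifold 𝓘(ℝ, EM) 1 M := IsManifold.of_le (n := ω) le_top
  have hc := (mdifferentiable_chart (I := 𝓘(ℝ, EM)) a).mdifferentiableAt_symm hy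
  have h := HasMFDerivAt.comp y hψ.hasMFDerivAt hc.hasMFDerivAt
  exact ⟨h.mdifferentiableAt.differentiableAt, (mfderiv_eq_fderiv (𝕜 := ℝ)).symm.trans h.mfderiv⟩

/-- A real-analytic injective immersion `ψ` with continuous inverse `φ : N → M` embeds `M` as the
real-analytic submanifold `N`, and `φ` is real-analytic. -/
theorem isEmbeddedSubmanifold_of_analytic_immersion [FiniteDimensional ℝ EM]
    [FiniteDimensional ℝ E] {ψ : M → E} {φ : E → M} {N : Set E}
    (hψ : ContMDiff 𝓘(ℝ, EM) 𝓘(ℝ, E) ω ψ)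
    (hinj : ∀ x, Function.Injective (mfderiv 𝓘(ℝ, EM) 𝓘(ℝ, E) ψ x))
    (hφ : ContinuousOn φ N) (hψφ : ∀ z ∈ N, ψ (φ z) = z) (hmem : ∀ x, ψ x ∈ N) :
    IsEmbeddedSubmanifold ω N ∧ ContMDiffOn 𝓘(ℝ, E) 𝓘(ℝ, EM) ω φ N := by
  have : IsManifold 𝓘(ℝ, EM) 1 M := IsManifold.of_le (n := ω) le_top
  suffices h : ∀ z ∈ N, (∃ (L : Submodule ℝ E) (e : OpenPartialHomeomorph E E),
      Module.finrank ℝ L = Module.finrank ℝ EM ∧ z ∈ e.source ∧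
      ContDiffOn ℝ ω e e.source ∧ ContDiffOn ℝ ω e.symm e.target ∧
      ∀ x ∈ e.source, x ∈ N ↔ e x ∈ L) ∧ ContMDiffWithinAt 𝓘(ℝ, E) 𝓘(ℝ, EM) ω φ N z from
    ⟨⟨_, fun z hz => (h z hz).1⟩, fun z hz => (h z hz).2⟩
  intro z hz
  set c := chartAt EM (φ z) with hc
  have hac : φ z ∈ c.source := mem_chart_source EM (φ z)
  have hyc : c (φ z) ∈ c.target := c.map_source hac
  let f : EM → E := ψ ∘ c.symm
  have hfz : f (c (φ z)) = z := by simp [f, c.left_inv hac, hψφ z hz]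
  have hcs : ContMDiffAt 𝓘(ℝ, EM) 𝓘(ℝ, EM) ω c.symm (c (φ z)) :=
    contMDiffOn_chart_symm.contMDiffAt (c.open_target.mem_nhds hyc)
  have hf : ContDiffAt ℝ ω f (c (φ z)) :=
    contMDiffAt_iff_contDiffAt.1 (ContMDiffAt.comp _ hψ.contMDiffAt hcs)
  have hfinj : Function.Injective (fderiv ℝ f (c (φ z))) := by
    have := (mfderiv_comp_chartAt_symm (ψ := ψ) hyc
      (hψ.mdifferentiable (by simp) _)).2
    rw [this]
    exact (hinj _).comp ((mdifferentiable_chart (I := 𝓘(ℝ, EM)) (φ z)).symm.mfderiv_injective hyc)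
  obtain ⟨L, e, g, hL, hze, he, hes, hg, hLN, hev⟩ :=
    exists_slice_chart_of_injective_fderiv hf hfinj
  rw [hfz] at hze
  have hφz : ContinuousWithinAt φ N z := hφ z hz
  -- Continuity of `φ` on `N` enters here: points of `N` close to `z` come from points of `M` close
  -- to `φ z`, so no other sheet of `N` accumulates at `z`.
  have hev' : ∀ᶠ w in 𝓝[N] z, w ∈ e.source → e w ∈ L ∧ c.symm (g w) = φ w := by
    have h1 : Filter.Tendsto (fun w => c (φ w)) (𝓝[N] z) (𝓝 (c (φ z))) :=
      (c.continuousAt hac).tendsto.comp hφz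
    filter_upwards [h1.eventually hev, hφz.eventually (c.open_source.mem_nhds hac),
      self_mem_nhdsWithin] with w hw hwc hwN hwe
    have h2 : f (c (φ w)) = w := by simp [f, c.left_inv hwc, hψφ w hwN]
    rw [h2] at hw
    refine ⟨(hw hwe).1, ?_⟩
    rw [(hw hwe).2, c.left_inv hwc]
  obtain ⟨O, hO, hzO, hON⟩ := mem_nhdsWithin.1 hev'
  refine ⟨⟨L, e.restrOpen O hO, hL, ?_, ?_, ?_, ?_⟩, ?_⟩
  · rw [e.restrOpen_source]
    exact ⟨hze, hzO⟩
  · refine he.mono ?_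
    rw [e.restrOpen_source]
    exact inter_subset_left
  · exact hes.mono fun u hu => hu.1
  · intro w hw
    rw [e.restrOpen_source] at hw
    refine ⟨fun h => (hON ⟨hw.2, h⟩ hw.1).1, fun h => ?_⟩
    rw [← hLN w hw.1 h]
    exact hmem _
  · have hgz : g z = c (φ z) := by
      have := hev.self_of_nhds
      rw [hfz] at this
      exact (this hze).2
    have hgc : ContMDiffAt 𝓘(ℝ, E) 𝓘(ℝ, EM) ω g z :=
      (hg.contDiffAt (e.open_source.mem_nhds hze)).contMDiffAt
    have h1 := ContMDiffAt.comp_of_eq hcs hgc hgz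
    refine h1.contMDiffWithinAt.congr_of_eventuallyEq ?_ ?_
    · filter_upwards [hev', mem_nhdsWithin_of_mem_nhds (e.open_source.mem_nhds hze)] with w h2 h3
      exact (h2 h3).2.symm
    · exact (hON ⟨hzO, hz⟩ hze).2.symm

/-- The coordinate representation, in the chart around `a`, of a vector field. -/
noncomputable def chartField (ξ : ∀ x : M, TangentSpace 𝓘(ℝ, EM) x) (a : M) (y : EM) : EM :=
  mfderiv 𝓘(ℝ, EM) 𝓘(ℝ, EM) (chartAt EM a) ((chartAt EM a).symm y) (ξ ((chartAt EM a).symm y))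

theorem fderiv_chartField {ψ : M → E} {a : M} {y : EM} (hy : y ∈ (chartAt EM a).target)
    (hψ : MDifferentiableAt 𝓘(ℝ, EM) 𝓘(ℝ, E) ψ ((chartAt EM a).symm y))
    (ξ : ∀ x : M, TangentSpace 𝓘(ℝ, EM) x) :
    fderiv ℝ (ψ ∘ (chartAt EM a).symm) y (chartField ξ a y) =
      mfderiv 𝓘(ℝ, EM) 𝓘(ℝ, E) ψ ((chartAt EM a).symm y) (ξ ((chartAt EM a).symm y)) := by
  have : IsManifold 𝓘(ℝ, EM) 1 M := IsManifold.of_le (n := ω) le_top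
  rw [(mfderiv_comp_chartAt_symm hy hψ).2]
  have h := (mdifferentiable_chart (I := 𝓘(ℝ, EM)) a).symm_comp_deriv
    ((chartAt EM a).map_target hy)
  rw [(chartAt EM a).right_inv hy] at h
  exact congrArg _ (DFunLike.congr_fun h (ξ ((chartAt EM a).symm y)))

theorem IsAnalyticField.contDiffAt_chartField {ξ : ∀ x : M, TangentSpace 𝓘(ℝ, EM) x} {W : Set M}
    {a : M} (hξ : IsAnalyticField ξ W) (hW : W ∈ 𝓝 a) :
    ContDiffAt ℝ ω (chartField ξ a) (chartAt EM a a) := by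
  have : IsManifold 𝓘(ℝ, EM) 1 M := IsManifold.of_le (n := ω) le_top
  have hac := mem_chart_source EM a
  have hyc := (chartAt EM a).map_source hac
  have h1 := (Bundle.contMDiffAt_section (IB := 𝓘(ℝ, EM)) (F := EM) a).1 (hξ.contMDiffAt hW)
  have hcs : ContMDiffAt 𝓘(ℝ, EM) 𝓘(ℝ, EM) ω (chartAt EM a).symm (chartAt EM a a) :=
    contMDiffOn_chart_symm.contMDiffAt ((chartAt EM a).open_target.mem_nhds hyc)
  have h2 := contMDiffAt_iff_contDiffAt.1 (ContMDiffAt.comp_of_eq h1 hcs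
    ((chartAt EM a).left_inv hac))
  refine h2.congr_of_eventuallyEq ?_
  filter_upwards [(chartAt EM a).open_target.mem_nhds hyc] with y hy
  have hx := (chartAt EM a).map_target hy
  have h3 := TangentBundle.continuousLinearMapAt_trivializationAt (I := 𝓘(ℝ, EM)) hx
  have h4 := DFunLike.congr_fun h3 (ξ ((chartAt EM a).symm y))
  rw [Bundle.Trivialization.continuousLinearMapAt_apply,
    Bundle.Trivialization.coe_linearMapAt_of_mem _ hx] at h4
  exact h4.symm

end Manifold

/-! ### Tangent cones and differentials of mutually inverse maps -/

/-- The tube is invariant under translations by `V`, so the line `z + ℝ v` stays in it. -/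
theorem mem_tangentConeAt_inter_tube {E : Type*} [NormedAddCommGroup E] [NormedSpace ℂ E]
    {V : Submodule ℝ E} {F : Set V} {O : Set E} (hO : IsOpen O) {z : E} (hz : z ∈ O ∩ tube V F)
    {v : E} (hv : v ∈ V) : v ∈ tangentConeAt ℝ (O ∩ tube V F) z := by
  obtain ⟨hzO, x, y, hy, rfl⟩ := hz
  rw [inter_comm, tangentConeAt_inter_nhds (hO.mem_nhds hzO)]
  refine mem_tangentConeAt_of_add_smul_mem (l := 𝓝[≠] (0 : ℝ)) Filter.tendsto_id ?_
  refine Filter.Eventually.of_forall fun t => ⟨x + t • ⟨v, hv⟩, y, hy, ?_⟩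
  simp only [id, Submodule.coe_add, Submodule.coe_smul]
  abel

section Inverse

variable {EM : Type*} [NormedAddCommGroup EM] [NormedSpace ℝ EM]
  {M : Type*} [TopologicalSpace M] [ChartedSpace EM M]
  {E : Type*} [NormedAddCommGroup E] [NormedSpace ℝ E]
  {N : Set E} {φ : E → M} {ψ : M → E}

theorem mfderiv_mem_tangentConeAt {x : M} (hψ : MDifferentiableAt 𝓘(ℝ, EM) 𝓘(ℝ, E) ψ x)
    (hmem : ∀ x, ψ x ∈ N) (w : TangentSpace 𝓘(ℝ, EM) x) :
    (mfderiv 𝓘(ℝ, EM) 𝓘(ℝ, E) ψ x w : E) ∈ tangentConeAt ℝ N (ψ x) := by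
  have h1 : HasFDerivWithinAt (writtenInExtChartAt 𝓘(ℝ, EM) 𝓘(ℝ, E) x ψ)
      (mfderiv 𝓘(ℝ, EM) 𝓘(ℝ, E) ψ x) (range 𝓘(ℝ, EM)) (extChartAt 𝓘(ℝ, EM) x x) :=
    hψ.hasMFDerivAt.2
  have h2 := h1.mapsTo_tangent_cone
    (show (w : EM) ∈ tangentConeAt ℝ (range 𝓘(ℝ, EM)) (extChartAt 𝓘(ℝ, EM) x x) by
      simp only [modelWithCornersSelf_coe, range_id, tangentConeAt_univ]; trivial)
  have h3 : writtenInExtChartAt 𝓘(ℝ, EM) 𝓘(ℝ, E) x ψ (extChartAt 𝓘(ℝ, EM) x x) = ψ x := by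
    simp [writtenInExtChartAt, chartAt_self_eq]
  rw [h3] at h2
  refine tangentConeAt_mono ?_ h2
  rintro _ ⟨y, -, rfl⟩
  exact hmem _

/-- The chain rule for `ψ ∘ φ = id` on `N`. As `N` may have empty interior in `E`, a derivative
within `N` is determined only on the tangent cone, whence the restriction on `v`. -/
theorem mfderiv_mfderivWithin_of_leftInvOn {z : E} (hz : z ∈ N)
    (hφ : MDifferentiableWithinAt 𝓘(ℝ, E) 𝓘(ℝ, EM) φ N z)
    (hψ : MDifferentiableAt 𝓘(ℝ, EM) 𝓘(ℝ, E) ψ (φ z)) (hψφ : ∀ z ∈ N, ψ (φ z) = z)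
    {v : E} (hv : v ∈ tangentConeAt ℝ N z) :
    mfderiv 𝓘(ℝ, EM) 𝓘(ℝ, E) ψ (φ z) (mfderivWithin 𝓘(ℝ, E) 𝓘(ℝ, EM) φ N z v) = v := by
  let D : E →L[ℝ] EM := mfderivWithin 𝓘(ℝ, E) 𝓘(ℝ, EM) φ N z
  let P : EM →L[ℝ] E := mfderiv 𝓘(ℝ, EM) 𝓘(ℝ, E) ψ (φ z)
  have h1 : HasFDerivWithinAt (ψ ∘ φ) (P.comp D) N z :=
    hasMFDerivWithinAt_iff_hasFDerivWithinAt.1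
      (hψ.hasMFDerivAt.comp_hasMFDerivWithinAt z hφ.hasMFDerivWithinAt)
  have h2 : HasFDerivWithinAt (ψ ∘ φ) (ContinuousLinearMap.id ℝ E) N z :=
    (hasFDerivWithinAt_id z N).congr hψφ (hψφ z hz)
  exact h1.unique_on h2 hv

theorem mfderivWithin_mfderiv_of_rightInverse {x : M}
    (hφ : MDifferentiableWithinAt 𝓘(ℝ, E) 𝓘(ℝ, EM) φ N (ψ x))
    (hψ : MDifferentiableAt 𝓘(ℝ, EM) 𝓘(ℝ, E) ψ x) (hmem : ∀ x, ψ x ∈ N)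
    (hφψ : ∀ x, φ (ψ x) = x) (w : TangentSpace 𝓘(ℝ, EM) x) :
    mfderivWithin 𝓘(ℝ, E) 𝓘(ℝ, EM) φ N (ψ x) (mfderiv 𝓘(ℝ, EM) 𝓘(ℝ, E) ψ x w) = w := by
  have h1 : HasMFDerivWithinAt 𝓘(ℝ, EM) 𝓘(ℝ, EM) (φ ∘ ψ) univ x _ :=
    hφ.hasMFDerivWithinAt.comp x hψ.hasMFDerivAt.hasMFDerivWithinAt fun y _ => hmem y
  rw [hasMFDerivWithinAt_univ, show φ ∘ ψ = id from funext hφψ] at h1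
  exact DFunLike.congr_fun (hasMFDerivAt_unique h1 (hasMFDerivAt_id x)) w

end Inverse

/-! ### Analyticity of CR maps determined by vector fields -/

section CR

variable {EM : Type*} [NormedAddCommGroup EM] [NormedSpace ℝ EM] [FiniteDimensional ℝ EM]
  {M : Type*} [TopologicalSpace M] [ChartedSpace EM M] [IsManifold 𝓘(ℝ, EM) ω M]
  {E : Type*} [NormedAddCommGroup E] [NormedSpace ℂ E] [FiniteDimensional ℂ E]

namespace CRStructure

/-- A differentiable map `ψ` into a complex vector space which is complex linear on the holomorphic
tangent spaces and constant along analytic vector fields `ξ j` is real-analytic near every point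
where the `ξ j`, together with the holomorphic tangent space, determine the differential. -/
theorem contMDiffAt_omega_of_diffC (S : CRStructure EM M) {ψ : M → E}
    (hψ : MDifferentiable 𝓘(ℝ, EM) 𝓘(ℝ, E) ψ)
    (hJ : ∀ (x : M) (v : S.H x), diffC (E := E) ψ x (S.J x v : TangentSpace 𝓘(ℝ, EM) x) =
      Complex.I • diffC (E := E) ψ x (v : TangentSpace 𝓘(ℝ, EM) x))
    {κ : Type*} [Fintype κ] {ξ : κ → ∀ x : M, TangentSpace 𝓘(ℝ, EM) x} {b : κ → E} {a : M}
    {W : Set M} (hW : W ∈ 𝓝 a) (hξ : ∀ j, IsAnalyticField (ξ j) W)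
    (hψξ : ∀ x ∈ W, ∀ j, diffC (E := E) ψ x (ξ j x) = b j)
    (huniq : ∀ q : TangentSpace 𝓘(ℝ, EM) a →L[ℝ] E,
      (∀ v : S.H a, q (S.J a v : TangentSpace 𝓘(ℝ, EM) a) =
        Complex.I • q (v : TangentSpace 𝓘(ℝ, EM) a)) → (∀ j, q (ξ j a) = 0) → q = 0) :
    ContMDiffAt 𝓘(ℝ, EM) 𝓘(ℝ, E) ω ψ a := by
  have : IsManifold 𝓘(ℝ, EM) 1 M := IsManifold.of_le (n := ω) le_top
  obtain ⟨U, hU, r, X, Y, hXY, hframe⟩ := S.exists_frame a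
  set c := chartAt EM a with hc
  have hac : a ∈ c.source := mem_chart_source EM a
  have hyc : c a ∈ c.target := c.map_source hac
  have hca : c.symm (c a) = a := c.left_inv hac
  have htend : Filter.Tendsto c.symm (𝓝 (c a)) (𝓝 a) := by
    have := (c.continuousAt_symm hyc).tendsto
    rwa [hca] at this
  have hP : ContDiffAt ℝ ω (fderiv ℝ (ψ ∘ c.symm)) (c a) := by
    -- The equations from `Fin r` say `P (J X i) = i P (X i)`, where `Y i = J X i`; those from `κ`
    -- say `P (ξ j) = b j`, where the zero field removes the second term.
    refine contDiffAt_omega_of_linear_system (κ := Fin r ⊕ κ)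
      (Complex.I • ContinuousLinearMap.id ℝ E)
      (Y := Sum.elim (fun i => chartField (Y i) a) (fun j => chartField (ξ j) a))
      (Z := Sum.elim (fun i => chartField (X i) a) (fun _ _ => 0))
      (b := Sum.elim (fun _ => 0) b) ?_ ?_ ?_ ?_
    · rintro (i | j)
      · exact (hXY i).2.contDiffAt_chartField hU
      · exact (hξ j).contDiffAt_chartField hW
    · rintro (i | j)
      · exact (hXY i).1.contDiffAt_chartField hU
      · exact contDiffAt_const
    · filter_upwards [c.open_target.mem_nhds hyc, htend.eventually hU, htend.eventually hW]
        with y hy hyU hyW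
      rintro (i | j)
      · obtain ⟨h, hXi⟩ := (hframe _ hyU).2.2 i
        have := hJ _ ⟨_, h⟩
        rw [hXi] at this
        simp only [Sum.elim_inl, smul_apply, ContinuousLinearMap.id_apply]
        rw [sub_eq_zero, fderiv_chartField hy (hψ _), fderiv_chartField hy (hψ _)]
        exact this
      · simp only [Sum.elim_inr, map_zero, sub_zero]
        rw [fderiv_chartField hy (hψ _)]
        exact hψξ _ hyW j
    · intro Q hQ
      let D : TangentSpace 𝓘(ℝ, EM) a →L[ℝ] EM := mfderiv 𝓘(ℝ, EM) 𝓘(ℝ, EM) c a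
      have hD : ∀ η : ∀ x : M, TangentSpace 𝓘(ℝ, EM) x, chartField η a (c a) = D (η a) := by
        intro η
        change mfderiv 𝓘(ℝ, EM) 𝓘(ℝ, EM) c (c.symm (c a)) (η (c.symm (c a))) = _
        rw [hca]
        rfl
      have hq : Q.comp D = 0 := by
        refine huniq _ ?_ ?_
        · intro v
          -- The system gives compatibility with `J` only on the frame; real linearity of both sides
          -- extends it to the span, which is all of `H a`.
          let l₁ : S.H a →ₗ[ℝ] E := ((Q.comp D : TangentSpace 𝓘(ℝ, EM) a →L[ℝ] E) :
            TangentSpace 𝓘(ℝ, EM) a →ₗ[ℝ] E) ∘ₗ (S.H a).subtype ∘ₗ S.J a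
          let l₂ : S.H a →ₗ[ℝ] E := (Complex.I • (LinearMap.id : E →ₗ[ℝ] E)) ∘ₗ
            ((Q.comp D : TangentSpace 𝓘(ℝ, EM) a →L[ℝ] E) :
            TangentSpace 𝓘(ℝ, EM) a →ₗ[ℝ] E) ∘ₗ (S.H a).subtype
          obtain ⟨-, hspan, hXi⟩ := hframe a (mem_of_mem_nhds hU)
          have key : ∀ w, ∀ hw : w ∈ Submodule.span ℝ (range fun i => X i a),
              l₁ ⟨w, hspan ▸ hw⟩ = l₂ ⟨w, hspan ▸ hw⟩ := by
            intro w hw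
            induction hw using Submodule.span_induction with
            | mem w hw =>
              obtain ⟨i, rfl⟩ := hw
              obtain ⟨h, hJi⟩ := hXi i
              have h1 := hQ (Sum.inl i)
              simp only [Sum.elim_inl, hD, sub_eq_zero] at h1
              change Q (D (S.J a ⟨X i a, h⟩ : TangentSpace 𝓘(ℝ, EM) a)) = _
              rw [hJi]
              exact h1
            | zero => exact (map_zero l₁).trans (map_zero l₂).symm
            | add w₁ w₂ h₁ h₂ e₁ e₂ =>
              exact (map_add l₁ ⟨w₁, hspan ▸ h₁⟩ ⟨w₂, hspan ▸ h₂⟩).trans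
                ((congrArg₂ (· + ·) e₁ e₂).trans (map_add l₂ _ _).symm)
            | smul t w h e =>
              exact (map_smul l₁ t ⟨w, hspan ▸ h⟩).trans
                ((congrArg (t • ·) e).trans (map_smul l₂ _ _).symm)
          exact key v (hspan.symm ▸ v.2)
        · intro j
          have h1 := hQ (Sum.inr j)
          simp only [Sum.elim_inr, hD, map_zero, sub_zero] at h1
          exact h1
      ext w
      obtain ⟨u, rfl⟩ := (mdifferentiable_chart (I := 𝓘(ℝ, EM)) a).mfderiv_surjective hac w
      exact DFunLike.congr_fun hq u
  have hf : ContDiffAt ℝ ω (ψ ∘ c.symm) (c a) := by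
    have : CompleteSpace E := FiniteDimensional.complete ℂ E
    refine (analyticAt_of_analyticAt_fderiv ?_ hP.analyticAt).contDiffAt
    filter_upwards [c.open_target.mem_nhds hyc] with y hy
    exact (mfderiv_comp_chartAt_symm hy (hψ _)).1
  have h1 : ContMDiffAt 𝓘(ℝ, EM) 𝓘(ℝ, EM) ω c a :=
    contMDiffOn_chart.contMDiffAt (c.open_source.mem_nhds hac)
  refine (hf.contMDiffAt.comp a h1).congr_of_eventuallyEq ?_
  filter_upwards [c.open_source.mem_nhds hac] with x hx
  simp [c.left_inv hx]

end CRStructure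

end CR

/-! ### The main theorem -/

/-- The inverse `ψ` of `φ` satisfies `dψ (ξ v) = v` for `v ∈ V` and `dψ ∘ J = i dψ` on `HM`. As `TM` is
spanned by the `ξ v` and by `J (ξ u)` for the `ξ u` in `HM`, this is a linear system with real-analytic
coefficients which determines `dψ`, so `ψ` is real-analytic. -/
theorem mainTheorem8
    {EM : Type*} [NormedAddCommGroup EM] [NormedSpace ℝ EM] [FiniteDimensional ℝ EM]
    {M : Type*} [TopologicalSpace M] [T2Space M] [SecondCountableTopology M] [ConnectedSpace M]
    [ChartedSpace EM M] [IsManifold 𝓘(ℝ, EM) ω M]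
    (S : CRStructure EM M)
    {EZ : Type*} [NormedAddCommGroup EZ] [NormedSpace ℂ EZ] [FiniteDimensional ℂ EZ]
    {Z : Type*} [TopologicalSpace Z] [T2Space Z] [SecondCountableTopology Z]
    [ChartedSpace EZ Z] [IsManifold 𝓘(ℂ, EZ) ω Z]
    (ι : M → Z) (hι : S.IsRealizedBy (EZ := EZ) ι)
    (hM : S.IsHolNondegenerate)
    {E : Type*} [NormedAddCommGroup E] [NormedSpace ℂ E] [FiniteDimensional ℂ E]
    (V : Submodule ℝ E) (hV : IsComplexificationOf V)
    (k : ℕ∞) (hk : 1 ≤ k)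
    (F : Set V) (hF : IsEmbeddedSubmanifold (k : ℕ∞ω) F)
    (N : Set E) (hN : ∃ O : Set E, IsOpen O ∧ N = O ∩ tube V F)
    (φ : E → M) (hφ : S.IsCRDiffeo (k : ℕ∞ω) N φ)
    (hv : ∀ v ∈ V, ∃ ξ : ∀ x : M, TangentSpace 𝓘(ℝ, EM) x, S.IsHol univ ξ ∧
      ∀ z ∈ N, ξ (φ z) = mfderivWithin 𝓘(ℝ, E) 𝓘(ℝ, EM) φ N z v) :
    IsLocallyClosed N ∧ IsEmbeddedSubmanifold ω N ∧ S.IsCRDiffeo ω N φ := by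
  obtain ⟨O, hO, hNO⟩ := hN
  obtain ⟨hφk, hφH, ψ, hψφ, hφψ, hψk, hψH⟩ := hφ
  have hk0 : (k : ℕ∞ω) ≠ 0 := by
    have : k ≠ 0 := (zero_lt_one.trans_le hk).ne'
    exact_mod_cast this
  have hφd : MDifferentiableOn 𝓘(ℝ, E) 𝓘(ℝ, EM) φ N := hφk.mdifferentiableOn hk0
  have hψd : MDifferentiable 𝓘(ℝ, EM) 𝓘(ℝ, E) ψ := hψk.mdifferentiable hk0
  have hmem : ∀ x, ψ x ∈ N := fun x => (hφψ x).1
  have hright : ∀ (x : M) (w : TangentSpace 𝓘(ℝ, EM) x),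
      mfderivWithin 𝓘(ℝ, E) 𝓘(ℝ, EM) φ N (ψ x) (mfderiv 𝓘(ℝ, EM) 𝓘(ℝ, E) ψ x w) = w :=
    fun x w => mfderivWithin_mfderiv_of_rightInverse (hφd _ (hmem x)) (hψd x) hmem
      (fun y => (hφψ y).2) w
  have htangent : ∀ z ∈ N, ∀ v ∈ V, v ∈ tangentConeAt ℝ N z := by
    intro z hz v hvV
    rw [hNO] at hz ⊢
    exact mem_tangentConeAt_inter_tube hO hz hvV
  choose! ξ hξ hξφ using hv
  have hψξ : ∀ (x : M), ∀ v ∈ V, diffC (E := E) ψ x (ξ v x) = v := by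
    intro x v hvV
    obtain ⟨z, hz, rfl⟩ : ∃ z ∈ N, φ z = x := ⟨ψ x, hφψ x⟩
    rw [hξφ v hvV z hz]
    exact mfderiv_mfderivWithin_of_leftInvOn hz (hφd z hz) (hψd _) hψφ (htangent z hz v hvV)
  have hψω : ContMDiff 𝓘(ℝ, EM) 𝓘(ℝ, E) ω ψ := by
    intro a
    let B := Module.finBasis ℝ V
    refine S.contMDiffAt_omega_of_diffC hψd (fun x v => (hψH x v).2) (W := univ)
      Filter.univ_mem (ξ := fun j => ξ (B j)) (b := fun j => B j) (fun j => (hξ _ (B j).2).1)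
      (fun x _ j => hψξ x _ (B j).2) ?_
    intro q hqJ hqξ
    obtain ⟨z, hz, rfl⟩ : ∃ z ∈ N, φ z = a := ⟨ψ a, hφψ a⟩
    let D : E →L[ℝ] TangentSpace 𝓘(ℝ, EM) (φ z) := mfderivWithin 𝓘(ℝ, E) 𝓘(ℝ, EM) φ N z
    let P : TangentSpace 𝓘(ℝ, EM) (φ z) →L[ℝ] E := mfderiv 𝓘(ℝ, EM) 𝓘(ℝ, E) ψ (φ z)
    have hDP : ∀ w, D (P w) = w := by
      have := hright (φ z)
      rwa [hψφ z hz] at this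
    have hPt : ∀ w, P w ∈ tangentConeAt ℝ N z := by
      have := mfderiv_mem_tangentConeAt (hψd (φ z)) hmem
      rwa [hψφ z hz] at this
    have hPD : ∀ v ∈ V, P (D v) = v := fun v hvV =>
      mfderiv_mfderivWithin_of_leftInvOn hz (hφd z hz) (hψd _) hψφ (htangent z hz v hvV)
    have hqV : ∀ v ∈ V, q (D v) = 0 := by
      have h1 : (q.comp (D.comp V.subtypeL) : V →ₗ[ℝ] E) = 0 :=
        B.ext fun j => by
          have := hqξ j
          rw [hξφ _ (B j).2 z hz] at this
          exact this
      exact fun v hvV => LinearMap.congr_fun h1 ⟨v, hvV⟩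
    ext w
    -- Write `P w = v + iu` with `v, u ∈ V`. Both `u` and `iu = P (w - D v)` are tangent to `N`, so
    -- `D u` lies in `HM` and `J (D u) = w - D v`. Hence `q w = q (D v) + i q (D u) = 0`.
    obtain ⟨v, _, hvV, ⟨u, huV, rfl⟩, hvu⟩ :=
      Submodule.codisjoint_iff_exists_add_eq.1 hV.codisjoint (P w)
    have hu : (Complex.I • (LinearMap.id : E →ₗ[ℝ] E)) u = Complex.I • u := rfl
    rw [hu] at hvu
    have hPu : P (w - D v) = Complex.I • u := by
      rw [map_sub, hPD v hvV, ← hvu, add_sub_cancel_left]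
    obtain ⟨h, hJu⟩ := hφH z hz u ⟨htangent z hz u huV, hPu ▸ hPt _⟩
    have h1 : D (Complex.I • u) = w - D v := by rw [← hPu, hDP]
    have h2 := hqJ ⟨D u, h⟩
    have h3 : (S.J (φ z) ⟨D u, h⟩ : TangentSpace 𝓘(ℝ, EM) (φ z)) = w - D v := hJu.trans h1
    rw [h3, map_sub, hqV v hvV, hqV u huV, smul_zero, sub_zero] at h2
    exact h2
  have hinj : ∀ x, Function.Injective (mfderiv 𝓘(ℝ, EM) 𝓘(ℝ, E) ψ x) :=
    fun x => Function.LeftInverse.injective (hright x)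
  obtain ⟨hNs, hφω⟩ := isEmbeddedSubmanifold_of_analytic_immersion hψω hinj hφk.continuousOn
    hψφ hmem
  exact ⟨hNs.isLocallyClosed, hNs, hφω, hφH, ψ, hψφ, hφψ, hψω, hψH⟩
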